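/- **Setting.** Let $a\ge 1$, $d\ge 2$, and let $X_{ik}=\mu_i+\epsilon_{ik}$ ($i=1,\dots,a$, $k=1,2,\dots$) be independent $\mathbb R^d$-valued random vectors, where for each $i$ the $\epsilon_{ik}$ are identically distributed with $\mathbb E\,\epsilon_{i1}=0$ and $\mathbb E\|\epsilon_{i1}\|^4<\infty$, and $V_i=\operatorname{Cov}(\epsilon_{i1})$ has a positive diagonal. Group $i$ is observed through $X_{i1},\dots,X_{in_i}$; put $N=\sum_{i=1}^a n_i$. For a $d\times d$ matrix $A$ let $\operatorname{vech}(A)=(A_{jk})_{j\le k}\in\mathbb R^p$, $p=d(d+1)/2$, and $\operatorname{vech}^-(A)=(A_{jk})_{j<k}\in\mathbb R^{p_u}$, $p_u=d(d-1)/2$. Let $L$ and $M_1$ be the $p_u\times p$ matrices such that, for symmetric $A$, $(L\operatorname{vech}(A))_{jk}=A_{jk}$ and $(M_1\operatorname{vech}(A))_{jk}=A_{jj}+A_{kk}$ for $j<k$. For $v=\operatorname{vech}(V)$ and $r\in\mathbb R^{p_u}$ put $$M(v,r)=\bigl[L-\tfrac12\operatorname{diag}(r)M_1\bigr]\,\operatorname{diag}\bigl((V_{jj}V_{kk})_{j\le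 k}\bigr)^{-1/2}.$$ Let $R_i$ be the correlation matrix belonging to $V_i$, $v_i=\operatorname{vech}(V_i)$, $r_i=\operatorname{vech}^-(R_i)$, $\Sigma_i=\operatorname{Cov}(\operatorname{vech}(\epsilon_{i1}\epsilon_{i1}^\top))$ and $\Upsilon_i=M(v_i,r_i)\,\Sigma_i\,M(v_i,r_i)^\top$. Let $\widehat v_i,\widehat r_i$ be obtained in the same way from the empirical covariance matrix $\widehat V_i$ of $X_{i1},\dots,X_{in_i}$, let $\widehat\Sigma_i$ be a consistent estimator of $\Sigma_i$ (a positive semidefinite matrix computed from the data, with $\widehat\Sigma_i\to\Sigma_i$ in probability), and put $\widehat\Upsilon_i=M(\widehat v_i,\widehat r_i)\,\widehat\Sigma_i\,M(\widehat v_i,\widehat r_i)^\top$. Given the data, let $Y^\dagger_{ik}$ ($i=1,\dots,a$, $k=1,\dots,n_i$) be independent with $Y^\dagger_{ik}\sim\mathcal N_{p_u}(0,\widehat\Upsilon_i)$. Let $\overline Y{}_i^\dagger$ and $\widehat\Upsilon{}_i^\dagger$ be the sample mean and the sample covariance matrix of $Y^\dagger_{i1},\dots,Y^\dagger_{in_i}$,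 let $\overline Y{}^\dagger=(\overline Y{}_1^{\dagger\top},\dots,\overline Y{}_a^{\dagger\top})^\top$, and let $\widehat\Upsilon{}^\dagger=\bigoplus_{i=1}^a\frac N{n_i}\widehat\Upsilon{}_i^\dagger$ and $\Upsilon=\bigoplus_{i=1}^a\kappa_i^{-1}\Upsilon_i$ (block diagonal matrices). **Theorem.** Suppose (A1): $n_i/N\to\kappa_i\in(0,1]$ for $i=1,\dots,a$ as $\min(n_1,\dots,n_a)\to\infty$. Then the following holds. (a) For each $i=1,\dots,a$, the conditional distribution of $\sqrt N\,\overline Y{}_i^\dagger$ given the data converges weakly to $\mathcal N_{p_u}(0,\kappa_i^{-1}\Upsilon_i)$ in probability. (b) The conditional distribution of $\sqrt N\,\overline Y{}^\dagger$ given the data converges weakly to $\mathcal N_{ap_u}(0,\Upsilon)$ in probability. Moreover $\widehat\Upsilon{}_i^\dagger\to\Upsilon_i$ for each $i$, and $\widehat\Upsilon{}^\dagger\to\Upsilon$, in probability. The requirement on $\widehat\Sigma_i$ is fulfilled, in particular, by the empirical covariance matrix (with factor $1/(n_i-1)$) of the vectors $\operatorname{vech}(\widetilde X_{ik}\widetilde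 X_{ik}^\top)$, $k=1,\dots,n_i$, where $\widetilde X_{ik}=X_{ik}-\overline X_i$. -/

import Mathlib

open MeasureTheory ProbabilityTheory Filter
open scoped Topology

noncomputable section

namespace CorrBootstrap

/-- Positions `(j, k)`, `j ≤ k`, of the upper triangle including the diagonal: the index set of the
half-vectorization (there are `d (d + 1) / 2` of them; the row-by-row numbering of the positions is
replaced by the positions themselves). -/
abbrev VechIdx (d : ℕ) : Type := {q : Fin d × Fin d // q.1 ≤ q.2}

/-- Positions `(j, k)`, `j < k`, strictly above the diagonal: the index set of the
upper-half-vectorization (there are `d (d - 1) / 2` of them). -/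
abbrev OffIdx (d : ℕ) : Type := {q : Fin d × Fin d // q.1 < q.2}

/-- The position of the `j`-th diagonal element in the half-vectorization. -/
def diagIdx {d : ℕ} (j : Fin d) : VechIdx d := ⟨(j, j), le_rfl⟩

/-- The half-vectorization `vech`. -/
def vech {d : ℕ} (A : Matrix (Fin d) (Fin d) ℝ) : VechIdx d → ℝ := fun q => A q.1.1 q.1.2

/-- The upper-half-vectorization `vech⁻`. -/
def vechOff {d : ℕ} (A : Matrix (Fin d) (Fin d) ℝ) : OffIdx d → ℝ := fun q => A q.1.1 q.1.2

/-- The elimination matrix `L` with `L * vech A = vech⁻ A`. -/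
def elimMatrix (d : ℕ) : Matrix (OffIdx d) (VechIdx d) ℝ :=
  Matrix.of fun l q => if q.1 = l.1 then 1 else 0

/-- The matrix `M₁`: its row at the position `(j, k)` is the sum of the two unit vectors that belong
to the `k`-th and to the `j`-th diagonal element. -/
def diagSumMatrix (d : ℕ) : Matrix (OffIdx d) (VechIdx d) ℝ :=
  Matrix.of fun l q =>
    (if q = diagIdx l.1.2 then 1 else 0) + (if q = diagIdx l.1.1 then 1 else 0)

/-- `M(v, r) = [L - ½ diag(r) M₁] diag(vech((v₁₁, …, v_dd)ᵀ (v₁₁, …, v_dd)))^{-1/2}`. -/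
def linMatrix {d : ℕ} (v : VechIdx d → ℝ) (r : OffIdx d → ℝ) :
    Matrix (OffIdx d) (VechIdx d) ℝ :=
  (elimMatrix d - (1 / 2 : ℝ) • (Matrix.diagonal r * diagSumMatrix d)) *
    Matrix.diagonal fun q => (√(v (diagIdx q.1.1) * v (diagIdx q.1.2)))⁻¹

/-- The correlation matrix that belongs to a covariance matrix `V`. -/
def corrMatrix {d : ℕ} (V : Matrix (Fin d) (Fin d) ℝ) : Matrix (Fin d) (Fin d) ℝ :=
  Matrix.of fun j k => V j k / (√(V j j) * √(V k k))

/-- `M(v, r) S M(v, r)ᵀ` with `v = vech V` and `r = vech⁻ R`, `R` the correlation matrix of `V`.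
With the population matrices `V`, `S` this is `Υ`, with estimated ones the estimator `Υ̂`. -/
def upsilon {d : ℕ} (V : Matrix (Fin d) (Fin d) ℝ) (S : Matrix (VechIdx d) (VechIdx d) ℝ) :
    Matrix (OffIdx d) (OffIdx d) ℝ :=
  linMatrix (vech V) (vechOff (corrMatrix V)) * S *
    (linMatrix (vech V) (vechOff (corrMatrix V))).transpose

/-- Population covariance matrix of a random vector. -/
def popCov {Ω ι : Type*} [MeasurableSpace Ω] (P : Measure Ω) (Z : Ω → ι → ℝ) : Matrix ι ι ℝ :=
  Matrix.of fun p q => covariance (fun ω => Z ω p) (fun ω => Z ω q) P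

/-- Sample mean. -/
def sampleMean {ι : Type*} {n : ℕ} (x : Fin n → EuclideanSpace ℝ ι) : EuclideanSpace ℝ ι :=
  (n : ℝ)⁻¹ • ∑ k, x k

/-- Sample (empirical) covariance matrix, with the factor `1 / (n - 1)`. -/
def sampleCov {ι : Type*} {n : ℕ} (x : Fin n → EuclideanSpace ℝ ι) : Matrix ι ι ℝ :=
  ((n : ℝ) - 1)⁻¹ •
    ∑ k, Matrix.vecMulVec (x k - sampleMean x).ofLp (x k - sampleMean x).ofLp

/-- The empirical covariance matrix of the vectors `vech (x̃ₖ x̃ₖᵀ)` with `x̃ₖ = xₖ - x̄`: the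
usual estimator of `Cov(vech(ε εᵀ))`. -/
def vechSampleCov {d n : ℕ} (x : Fin n → EuclideanSpace ℝ (Fin d)) :
    Matrix (VechIdx d) (VechIdx d) ℝ :=
  sampleCov fun k => WithLp.toLp 2
    (vech (Matrix.vecMulVec (x k - sampleMean x).ofLp (x k - sampleMean x).ofLp))

/-- The data set of all groups, `n i` observations in group `i`. -/
abbrev Data (a d : ℕ) (n : Fin a → ℕ) : Type :=
  (i : Fin a) → Fin (n i) → EuclideanSpace ℝ (Fin d)

/-- The array of bootstrap vectors, `n i` of them in group `i`. -/
abbrev BootArray (a d : ℕ) (n : Fin a → ℕ) : Type :=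
  (i : Fin a) → Fin (n i) → EuclideanSpace ℝ (OffIdx d)

/-- The data observed when the sample sizes are `n`. -/
def observed {Ω : Type*} {a d : ℕ} (X : Fin a → ℕ → Ω → EuclideanSpace ℝ (Fin d))
    (n : Fin a → ℕ) (ω : Ω) : Data a d n :=
  fun i k => X i k ω

/-- Entrywise convergence in probability of random matrices to a constant matrix. -/
def MatrixTendstoInProb {Ω ι : Type*} [MeasurableSpace Ω] (P : Measure Ω)
    (A : ℕ → Ω → Matrix ι ι ℝ) (B : Matrix ι ι ℝ) : Prop :=
  ∀ p q, TendstoInMeasure P (fun m ω => A m ω p q) atTop (fun _ => B p q)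

/-- `Shat m i` is, at stage `m` with sample sizes `n m`, a covariance matrix valued function of the
data, and `Shat · i` is a consistent sequence of estimators of `S i`. -/
structure IsConsistentCovEstimator {Ω : Type*} [MeasurableSpace Ω] (P : Measure Ω) {a d : ℕ}
    (X : Fin a → ℕ → Ω → EuclideanSpace ℝ (Fin d)) (n : ℕ → Fin a → ℕ)
    (S : Fin a → Matrix (VechIdx d) (VechIdx d) ℝ)
    (Shat : (m : ℕ) → Fin a → Data a d (n m) → Matrix (VechIdx d) (VechIdx d) ℝ) : Prop where
  measurable : ∀ m i p q, Measurable fun x => Shat m i x p q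
  posSemidef : ∀ m i, ∀ᵐ ω ∂P, (Shat m i (observed X (n m) ω)).PosSemidef
  consistent : ∀ i, MatrixTendstoInProb P (fun m ω => Shat m i (observed X (n m) ω)) (S i)

/-- `Υ̂ᵢ = M(v̂ᵢ, r̂ᵢ) Σ̂ᵢ M(v̂ᵢ, r̂ᵢ)ᵀ` as a function of the data `x`, where `v̂ᵢ`, `r̂ᵢ` come from
the sample covariance matrix of group `i` and `S` is the estimator `Σ̂ᵢ`. -/
def upsilonHat {a d : ℕ} {n : Fin a → ℕ}
    (S : Data a d n → Matrix (VechIdx d) (VechIdx d) ℝ) (i : Fin a) (x : Data a d n) :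
    Matrix (OffIdx d) (OffIdx d) ℝ :=
  upsilon (sampleCov (x i)) (S x)

/-- Parametric bootstrap: given the data, all the vectors `Y i k` are independent, and those of
group `i` have the distribution `N(0, Υ̂ᵢ)`. -/
def IsParametricBootstrap {Ω : Type*} [MeasurableSpace Ω] (P : Measure Ω) [IsProbabilityMeasure P]
    {a d : ℕ} (X : Fin a → ℕ → Ω → EuclideanSpace ℝ (Fin d)) (n : Fin a → ℕ)
    (Shat : Fin a → Data a d n → Matrix (VechIdx d) (VechIdx d) ℝ)
    (Y : Ω → BootArray a d n) : Prop :=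
  Measurable Y ∧
    ∀ᵐ x ∂(P.map (observed X n)), condDistrib Y (observed X n) P x =
      Measure.pi fun i => Measure.pi fun _ : Fin (n i) =>
        multivariateGaussian 0 (upsilonHat (Shat i) i x)

/-- The conditional distributions of `T m` given `D m` converge weakly to `ν` in probability: their
distance to `ν`, in the Lévy–Prokhorov metric of weak convergence, tends to `0` in probability. -/
def CondLawTendstoInProb {Ω E : Type*} {𝓓 : ℕ → Type*} [MeasurableSpace Ω]
    [∀ m, MeasurableSpace (𝓓 m)] [PseudoEMetricSpace E] [MeasurableSpace E] [StandardBorelSpace E]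
    [Nonempty E] (P : Measure Ω) [IsProbabilityMeasure P]
    (T : ℕ → Ω → E) (D : (m : ℕ) → Ω → 𝓓 m) (ν : Measure E) : Prop :=
  TendstoInMeasure P
    (fun m ω => levyProkhorovDist (condDistrib (T m) (D m) P (D m ω)) ν) atTop (fun _ => (0 : ℝ))

/-- The pooled vector of the group means. -/
def pooledMean {a d : ℕ} {n : Fin a → ℕ} (y : BootArray a d n) :
    EuclideanSpace ℝ (OffIdx d × Fin a) :=
  WithLp.toLp 2 fun q => sampleMean (y q.2) q.1

/-- Total sample size. -/
def total {a : ℕ} (n : Fin a → ℕ) : ℝ := ∑ i, (n i : ℝ)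

end CorrBootstrap

end

/-! Given the data, the bootstrap vectors are exactly Gaussian, so no conditional central limit
theorem is needed: `√N` times the mean of group `i` has conditional law `N(0, (N / nᵢ) Υ̂ᵢ)`, and
the pooled vector has the block diagonal analogue (`map_pi_pi_sampleMean`, `map_pi_pi_pooledMean`).
Since `A ↦ N(0, A)` is weakly continuous on the positive semidefinite matrices
(`tendsto_levyProkhorovDist_multivariateGaussian`, from Lévy's continuity theorem), (a) and (b)
reduce to the consistency of `Υ̂ᵢ`. That follows from the strong law for `V̂ᵢ`, the consistency of
`Σ̂ᵢ`, and the continuity of `upsilon` at a matrix with positive diagonal (`tendsto_upsilon`).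

The sample covariance of the bootstrap vectors needs more, because the sampled law changes with the
data and with the stage. Writing `N(0, A)` as the image of the standard Gaussian under `√A` turns
the deviation into `√A (W - 1) √A`, where `W` is a standard Gaussian sample covariance. Its entries
are controlled by the diagonal of `A`, so a single law of large numbers for `W` gives a bound
uniform over bounded diagonals (`pi_multivariateGaussian_sampleCov_le`). Integrating the conditional
bound over the data finishes the argument (`tendsto_measure_of_condDistrib`).

Convergence in probability to a constant is treated as convergence along the single filter
`probFilter`, so continuous maps, products and finite intersections act as for deterministic limits.
-/

namespace CorrBootstrap

/-! ### Convergence in probability as convergence along a filter -/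

section ProbFilter

variable {Ω : Type*} [MeasurableSpace Ω]

/-- The filter of the sets `W ⊆ ℕ × Ω` such that `(m, ω) ∈ W` with probability tending to one as
`m → ∞`. Convergence in probability is convergence along this filter. -/
def probFilter (P : Measure Ω) : Filter (ℕ × Ω) where
  sets := {W | Tendsto (fun m => P {ω | (m, ω) ∉ W}) atTop (𝓝 0)}
  univ_sets := by simp
  sets_of_superset := by
    intro W W' hW hsub
    exact tendsto_of_tendsto_of_tendsto_of_le_of_le tendsto_const_nhds hW (fun _ => zero_le)
      fun m => measure_mono fun ω hω h => hω (hsub h)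
  inter_sets := by
    intro W W' hW hW'
    have h := Tendsto.add hW hW'
    rw [add_zero] at h
    refine tendsto_of_tendsto_of_tendsto_of_le_of_le tendsto_const_nhds h (fun _ => zero_le)
      fun m => ?_
    refine (measure_mono ?_).trans (measure_union_le _ _)
    intro ω hω
    by_cases h1 : (m, ω) ∈ W
    · exact Or.inr fun h2 => hω ⟨h1, h2⟩
    · exact Or.inl h1

variable {P : Measure Ω}

lemma eventually_probFilter {q : ℕ → Ω → Prop} :
    (∀ᶠ p in probFilter P, q p.1 p.2) ↔ Tendsto (fun m => P {ω | ¬ q m ω}) atTop (𝓝 0) :=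
  Iff.rfl

lemma tendstoInMeasure_iff_tendsto_probFilter {E : Type*} [PseudoEMetricSpace E]
    {f : ℕ → Ω → E} {c : E} :
    TendstoInMeasure P f atTop (fun _ => c) ↔
      Tendsto (fun p : ℕ × Ω => f p.1 p.2) (probFilter P) (𝓝 c) := by
  rw [Metric.nhds_basis_eball.tendsto_right_iff]
  refine forall_congr' fun ε => imp_congr_right fun _ => ?_
  rw [eventually_probFilter (q := fun m ω => f m ω ∈ Metric.eball c ε)]
  simp only [Metric.mem_eball, not_lt]

lemma eventually_probFilter_of_ae {q : ℕ → Ω → Prop} (h : ∀ m, ∀ᵐ ω ∂P, q m ω) :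
    ∀ᶠ p in probFilter P, q p.1 p.2 := by
  rw [eventually_probFilter]
  have : (fun m => P {ω | ¬ q m ω}) = fun _ => 0 := funext fun m => h m
  rw [this]
  exact tendsto_const_nhds

lemma tendsto_fst_probFilter : Tendsto Prod.fst (probFilter P) atTop := by
  intro U hU
  change Tendsto (fun m => P {ω | m ∉ U}) atTop (𝓝 0)
  refine tendsto_const_nhds.congr' ?_
  filter_upwards [hU] with m hm
  simp [hm]

instance [IsProbabilityMeasure P] : (probFilter P).NeBot := by
  refine ⟨fun h => ?_⟩
  have h1 : ∅ ∈ probFilter P := by simp [h]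
  change Tendsto (fun m => P {ω | (m, ω) ∉ (∅ : Set (ℕ × Ω))}) atTop (𝓝 0) at h1
  simp at h1

lemma tendsto_probFilter_of_ae [IsFiniteMeasure P] {f : ℕ → Ω → ℝ} {c : ℝ}
    (hf : ∀ m, Measurable (f m)) (h : ∀ᵐ ω ∂P, Tendsto (fun m => f m ω) atTop (𝓝 c)) :
    Tendsto (fun p : ℕ × Ω => f p.1 p.2) (probFilter P) (𝓝 c) :=
  tendstoInMeasure_iff_tendsto_probFilter.1
    (tendstoInMeasure_of_tendsto_ae (fun m => (hf m).aestronglyMeasurable) h)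

/-- If the conditional probabilities of the events `W m`, given the data `D m`, tend to zero in
probability, then so do their probabilities. -/
lemma tendsto_measure_of_condDistrib [IsProbabilityMeasure P] {𝓓 𝓨 : ℕ → Type*}
    [∀ m, MeasurableSpace (𝓓 m)] [∀ m, MeasurableSpace (𝓨 m)] [∀ m, StandardBorelSpace (𝓨 m)]
    [∀ m, Nonempty (𝓨 m)] {D : (m : ℕ) → Ω → 𝓓 m} {Y : (m : ℕ) → Ω → 𝓨 m}
    (hD : ∀ m, Measurable (D m)) (hY : ∀ m, Measurable (Y m)) {W : (m : ℕ) → Set (𝓓 m × 𝓨 m)}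
    (hW : ∀ m, MeasurableSet (W m))
    (h : Tendsto (fun p : ℕ × Ω =>
      condDistrib (Y p.1) (D p.1) P (D p.1 p.2) {y | (D p.1 p.2, y) ∈ W p.1})
      (probFilter P) (𝓝 0)) :
    Tendsto (fun m => P {ω | (D m ω, Y m ω) ∈ W m}) atTop (𝓝 0) := by
  set g : ℕ → Ω → ENNReal := fun m ω =>
    condDistrib (Y m) (D m) P (D m ω) {y | (D m ω, y) ∈ W m} with hg
  have hgm : ∀ m, Measurable (g m) := fun m =>
    (Kernel.measurable_kernel_prodMk_left (κ := condDistrib (Y m) (D m) P) (hW m)).comp (hD m)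
  -- Disintegration: the joint law of data and `Y` is the law of the data composed with the
  -- conditional kernel.
  have key : ∀ m, P {ω | (D m ω, Y m ω) ∈ W m} = ∫⁻ ω, g m ω ∂P := by
    intro m
    have h1 : P {ω | (D m ω, Y m ω) ∈ W m} = (P.map fun ω => (D m ω, Y m ω)) (W m) := by
      rw [Measure.map_apply ((hD m).prodMk (hY m)) (hW m)]; rfl
    rw [h1, ← compProd_map_condDistrib (hY m).aemeasurable, Measure.compProd_apply (hW m),
      lintegral_map (Kernel.measurable_kernel_prodMk_left (hW m)) (hD m)]
    rfl
  have hle : ∀ m ω, g m ω ≤ 1 := fun m ω => prob_le_one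
  rw [ENNReal.tendsto_nhds_zero]
  intro δ hδ
  have hδ2 : 0 < δ / 2 := ENNReal.half_pos hδ.ne'
  have hev : ∀ᶠ p in probFilter P, g p.1 p.2 ≤ δ / 2 := (ENNReal.tendsto_nhds_zero.1 h) _ hδ2
  rw [eventually_probFilter (q := fun m ω => g m ω ≤ δ / 2), ENNReal.tendsto_nhds_zero] at hev
  filter_upwards [hev _ hδ2] with m hm
  rw [key m]
  have hset : MeasurableSet {ω | ¬ g m ω ≤ δ / 2} :=
    (measurableSet_le (hgm m) measurable_const).compl
  -- Bounded convergence by hand: the integrand is at most `δ / 2` off an event of probability at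
  -- most `δ / 2`, and at most `1` on it.
  calc ∫⁻ ω, g m ω ∂P
      ≤ ∫⁻ ω, (δ / 2 + {ω | ¬ g m ω ≤ δ / 2}.indicator 1 ω) ∂P := by
        refine lintegral_mono fun ω => ?_
        by_cases hω : g m ω ≤ δ / 2
        · exact hω.trans le_self_add
        · have : ω ∈ {ω | ¬ g m ω ≤ δ / 2} := hω
          rw [Set.indicator_of_mem this]
          exact (hle m ω).trans le_add_self
    _ = δ / 2 + P {ω | ¬ g m ω ≤ δ / 2} := by
        rw [lintegral_add_left measurable_const, lintegral_const, measure_univ, mul_one,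
          lintegral_indicator_one hset]
    _ ≤ δ / 2 + δ / 2 := by gcongr
    _ = δ := ENNReal.add_halves δ

end ProbFilter

/-! ### Gaussian laws: weak continuity in the covariance, means and products -/

section Gaussian

variable {ι : Type*} [Fintype ι]

/-- Lévy's continuity theorem, combined with the fact that the Lévy–Prokhorov distance metrizes weak
convergence. -/
lemma tendsto_levyProkhorovDist_of_seq {E : Type*} [NormedAddCommGroup E] [InnerProductSpace ℝ E]
    [FiniteDimensional ℝ E] [MeasurableSpace E] [BorelSpace E] {ν : ℕ → Measure E}
    [∀ k, IsProbabilityMeasure (ν k)] {ν₀ : Measure E} [IsProbabilityMeasure ν₀]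
    (h : ∀ t, Tendsto (fun k => charFun (ν k) t) atTop (𝓝 (charFun ν₀ t))) :
    Tendsto (fun k => levyProkhorovDist (ν k) ν₀) atTop (𝓝 0) := by
  let π : ℕ → ProbabilityMeasure E := fun k => ⟨ν k, inferInstance⟩
  let π₀ : ProbabilityMeasure E := ⟨ν₀, inferInstance⟩
  have h1 : Tendsto π atTop (𝓝 π₀) := ProbabilityMeasure.tendsto_of_tendsto_charFun h
  have h2 := (LevyProkhorov.continuous_ofMeasure_probabilityMeasure
    (Ω := E)).continuousAt.tendsto.comp h1
  exact tendsto_iff_dist_tendsto_zero.1 h2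

lemma dotProduct_blockDiagonal_mulVec {a : ℕ} (B : Fin a → Matrix ι ι ℝ) (x : ι × Fin a → ℝ) :
    x ⬝ᵥ (Matrix.blockDiagonal B).mulVec x =
      ∑ i, (fun p => x (p, i)) ⬝ᵥ (B i).mulVec fun p => x (p, i) := by
  simp only [dotProduct, Matrix.mulVec, Fintype.sum_prod_type, Matrix.blockDiagonal_apply]
  rw [Finset.sum_comm]
  refine Finset.sum_congr rfl fun i _ => Finset.sum_congr rfl fun p _ => ?_
  congr 1
  refine Finset.sum_congr rfl fun q _ => ?_
  simp

lemma posSemidef_blockDiagonal {a : ℕ} {B : Fin a → Matrix ι ι ℝ} (hB : ∀ i, (B i).PosSemidef) :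
    (Matrix.blockDiagonal B).PosSemidef := by
  refine Matrix.PosSemidef.of_dotProduct_mulVec_nonneg ?_ fun x => ?_
  · rw [Matrix.IsHermitian, Matrix.blockDiagonal_conjTranspose]
    congr 1
    ext1 i
    exact (hB i).1
  · rw [star_trivial, dotProduct_blockDiagonal_mulVec]
    exact Finset.sum_nonneg fun i _ => by
      simpa using (hB i).dotProduct_mulVec_nonneg fun p => x (p, i)

variable [DecidableEq ι]

/-- The characteristic function is explicit and continuous in the covariance. That formula requires
a positive semidefinite matrix, hence the restricted neighbourhood; countable generation of this
filter permits the passage to sequences. -/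
lemma tendsto_levyProkhorovDist_multivariateGaussian {B : Matrix ι ι ℝ} (hB : B.PosSemidef) :
    Tendsto (fun A : Matrix ι ι ℝ =>
        levyProkhorovDist (multivariateGaussian 0 A) (multivariateGaussian 0 B))
      (𝓝[{A | A.PosSemidef}] B) (𝓝 0) := by
  have : (𝓝[{A | A.PosSemidef}] B).IsCountablyGenerated := by
    have : FirstCountableTopology (Matrix ι ι ℝ) :=
      inferInstanceAs (FirstCountableTopology (ι → ι → ℝ))
    unfold nhdsWithin
    infer_instance
  refine tendsto_of_seq_tendsto fun A hA => ?_
  rw [tendsto_nhdsWithin_iff] at hA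
  obtain ⟨hA, hpos⟩ := hA
  obtain ⟨K, hK⟩ := eventually_atTop.1 hpos
  -- Dropping the first `K` terms makes every remaining matrix positive semidefinite.
  refine (tendsto_add_atTop_iff_nat K).1 ?_
  refine tendsto_levyProkhorovDist_of_seq fun t => ?_
  have hpos' : ∀ k, (A (k + K)).PosSemidef := fun k => hK _ (by omega)
  simp_rw [charFun_multivariateGaussian (hpos' _), charFun_multivariateGaussian hB]
  have hc : Continuous fun C : Matrix ι ι ℝ =>
      Complex.exp (inner ℝ t 0 * Complex.I - (t.ofLp ⬝ᵥ (C.mulVec t.ofLp) : ℝ) / 2) := by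
    fun_prop
  exact (hc.tendsto B).comp (hA.comp (tendsto_add_atTop_nat K))

/-- The characteristic function of the scaled mean at `t` is the product of those of the summands at
`(c / n) • t`. -/
lemma map_pi_multivariateGaussian_sampleMean {A : Matrix ι ι ℝ} (hA : A.PosSemidef) (n : ℕ)
    (c : ℝ) :
    (Measure.pi fun _ : Fin n => multivariateGaussian 0 A).map (fun y => c • sampleMean y) =
      multivariateGaussian 0 ((c ^ 2 / n) • A) := by
  have hm : Measurable fun y : Fin n → EuclideanSpace ℝ ι => c • sampleMean y := by
    unfold sampleMean; fun_prop
  have := Measure.isProbabilityMeasure_map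
    (μ := Measure.pi fun _ : Fin n => multivariateGaussian 0 A) hm.aemeasurable
  apply Measure.ext_of_charFun
  ext t
  have hsm : ((c ^ 2 / n) • A).PosSemidef := hA.smul (by positivity)
  rw [charFun_multivariateGaussian hsm, charFun_apply, integral_map hm.aemeasurable
    (Measurable.aestronglyMeasurable (by fun_prop))]
  have h1 : ∀ y : Fin n → EuclideanSpace ℝ ι,
      Complex.exp (inner ℝ (c • sampleMean y) t * Complex.I) =
        ∏ k, Complex.exp (inner ℝ (y k) ((c / n) • t) * Complex.I) := by
    intro y
    rw [← Complex.exp_sum, ← Finset.sum_mul, ← Complex.ofReal_sum, ← sum_inner, sampleMean,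
      smul_smul, real_inner_smul_left, real_inner_smul_right, div_eq_mul_inv]
  simp_rw [h1]
  rw [integral_fintype_prod_eq_prod
    (f := fun _ y => Complex.exp (inner ℝ y ((c / n) • t) * Complex.I))]
  simp_rw [← charFun_apply, charFun_multivariateGaussian hA]
  rw [← Complex.exp_sum]
  congr 1
  -- For `n = 0` the empty mean is `0` and `c ^ 2 / 0 = 0`, so both laws are the point mass at `0`.
  rcases eq_or_ne (n : ℝ) 0 with h0 | h0
  · have : n = 0 := by exact_mod_cast h0
    subst this
    simp
  · have h0' : (n : ℂ) ≠ 0 := by exact_mod_cast h0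
    simp [Matrix.mulVec_smul, Matrix.smul_mulVec]
    field_simp

lemma map_pi_multivariateGaussian_blockDiagonal {a : ℕ} {B : Fin a → Matrix ι ι ℝ}
    (hB : ∀ i, (B i).PosSemidef) :
    (Measure.pi fun i => multivariateGaussian 0 (B i)).map
        (fun z => (WithLp.toLp 2 fun q => z q.2 q.1 : EuclideanSpace ℝ (ι × Fin a))) =
      multivariateGaussian 0 (Matrix.blockDiagonal B) := by
  have hm : Measurable fun z : Fin a → EuclideanSpace ℝ ι =>
      (WithLp.toLp 2 fun q => z q.2 q.1 : EuclideanSpace ℝ (ι × Fin a)) := by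
    fun_prop
  have := Measure.isProbabilityMeasure_map
    (μ := Measure.pi fun i => multivariateGaussian 0 (B i)) hm.aemeasurable
  have hbd := posSemidef_blockDiagonal hB
  apply Measure.ext_of_charFun
  ext t
  rw [charFun_multivariateGaussian hbd, charFun_apply, integral_map hm.aemeasurable
    (Measurable.aestronglyMeasurable (by fun_prop))]
  have h1 : ∀ z : Fin a → EuclideanSpace ℝ ι,
      Complex.exp (inner ℝ (WithLp.toLp 2 fun q => z q.2 q.1 : EuclideanSpace ℝ (ι × Fin a)) t
        * Complex.I) =
      ∏ i, Complex.exp (inner ℝ (z i) (WithLp.toLp 2 fun p => t (p, i)) * Complex.I) := by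
    intro z
    rw [← Complex.exp_sum, ← Finset.sum_mul, ← Complex.ofReal_sum]
    congr 3
    simp only [PiLp.inner_apply, Fintype.sum_prod_type]
    rw [Finset.sum_comm]
  simp_rw [h1]
  rw [integral_fintype_prod_eq_prod
    (f := fun i z => Complex.exp (inner ℝ z (WithLp.toLp 2 fun p => t (p, i)) * Complex.I))]
  simp_rw [← charFun_apply, charFun_multivariateGaussian (hB _)]
  rw [← Complex.exp_sum, dotProduct_blockDiagonal_mulVec]
  congr 1
  simp [Finset.sum_neg_distrib, Finset.sum_div]

end Gaussian
-- Algebra and deterministic limits of sample covariances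
section SampleCov

variable {ι : Type*} {n : ℕ}

lemma sampleMean_apply (x : Fin n → EuclideanSpace ℝ ι) (p : ι) :
    sampleMean x p = (n : ℝ)⁻¹ * ∑ k, x k p := by
  simp [sampleMean]

/-- The estimators see the data only through residuals, which is why the `X i k` can later be
replaced by the centred errors. -/
lemma sub_sampleMean_const_add (c : EuclideanSpace ℝ ι) (x : Fin n → EuclideanSpace ℝ ι)
    (k : Fin n) :
    (c + x k) - sampleMean (fun l => c + x l) = x k - sampleMean x := by
  have hn : (n : ℝ) ≠ 0 := by
    have := k.pos
    positivity
  have : sampleMean (fun l => c + x l) = c + sampleMean x := by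
    rw [sampleMean, sampleMean, Finset.sum_add_distrib, smul_add]
    congr 1
    rw [Finset.sum_const, Finset.card_univ, Fintype.card_fin, ← Nat.cast_smul_eq_nsmul ℝ,
      smul_smul, inv_mul_cancel₀ hn, one_smul]
  rw [this]
  abel

lemma sampleCov_const_add (c : EuclideanSpace ℝ ι) (x : Fin n → EuclideanSpace ℝ ι) :
    sampleCov (fun k => c + x k) = sampleCov x := by
  simp only [sampleCov, sub_sampleMean_const_add]

lemma vechSampleCov_const_add {d : ℕ} (c : EuclideanSpace ℝ (Fin d))
    (x : Fin n → EuclideanSpace ℝ (Fin d)) :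
    vechSampleCov (fun k => c + x k) = vechSampleCov x := by
  simp only [vechSampleCov, sub_sampleMean_const_add]

lemma sampleCov_apply (x : Fin n → EuclideanSpace ℝ ι) (p q : ι) :
    sampleCov x p q = (n : ℝ) / ((n : ℝ) - 1) *
      ((n : ℝ)⁻¹ * ∑ k, x k p * x k q - ((n : ℝ)⁻¹ * ∑ k, x k p) * ((n : ℝ)⁻¹ * ∑ k, x k q)) := by
  rcases Nat.eq_zero_or_pos n with rfl | hn
  · simp [sampleCov]
  have hn' : (n : ℝ) ≠ 0 := by positivity
  simp only [sampleCov, Matrix.smul_apply, Matrix.sum_apply, Matrix.vecMulVec_apply, smul_eq_mul,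
    PiLp.sub_apply, sampleMean_apply, sub_mul, mul_sub, Finset.sum_sub_distrib, Finset.sum_const,
    Finset.card_univ, Fintype.card_fin, nsmul_eq_mul, ← Finset.sum_mul, ← Finset.mul_sum]
  rw [div_eq_mul_inv]
  field_simp
  ring

lemma posSemidef_sampleCov [Finite ι] (x : Fin n → EuclideanSpace ℝ ι) :
    (sampleCov x).PosSemidef := by
  have := Fintype.ofFinite ι
  -- For `n = 0` the factor is `-1`, but the sum is empty; for `n = 1` the factor is `0⁻¹ = 0`.
  rcases Nat.eq_zero_or_pos n with rfl | hn
  · simpa [sampleCov] using Matrix.PosSemidef.zero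
  refine Matrix.PosSemidef.smul (Matrix.posSemidef_sum _ fun k _ => ?_) ?_
  · simpa using Matrix.posSemidef_vecMulVec_self_star (x k - sampleMean x).ofLp
  · have : (1 : ℝ) ≤ n := by exact_mod_cast hn
    exact inv_nonneg.2 (by linarith)

/-- The mean of the first `n` terms of a sequence. -/
noncomputable def avg (u : ℕ → ℝ) (n : ℕ) : ℝ := (∑ k ∈ Finset.range n, u k) / n

lemma inv_mul_sum_fin (u : ℕ → ℝ) (n : ℕ) : (n : ℝ)⁻¹ * ∑ k : Fin n, u k = avg u n := by
  rw [avg, Fin.sum_univ_eq_sum_range, div_eq_inv_mul]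

lemma tendsto_div_sub_one : Tendsto (fun n : ℕ => (n : ℝ) / ((n : ℝ) - 1)) atTop (𝓝 1) := by
  have h : Tendsto (fun n : ℕ => (1 - (n : ℝ)⁻¹)⁻¹) atTop (𝓝 1) := by
    have := ((tendsto_const_nhds (x := (1 : ℝ))).sub
      (tendsto_inv_atTop_nhds_zero_nat (𝕜 := ℝ))).inv₀ (by simp)
    simpa using this
  refine h.congr' ?_
  filter_upwards [eventually_gt_atTop 0] with n hn
  have : (n : ℝ) ≠ 0 := by positivity
  rw [show (1 : ℝ) - (n : ℝ)⁻¹ = ((n : ℝ) - 1) / n by field_simp, inv_div]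

lemma tendsto_sampleCov {x : ℕ → EuclideanSpace ℝ ι} {p q : ι} {b c e : ℝ}
    (h2 : Tendsto (avg fun k => x k p * x k q) atTop (𝓝 b))
    (hp : Tendsto (avg fun k => x k p) atTop (𝓝 c))
    (hq : Tendsto (avg fun k => x k q) atTop (𝓝 e)) :
    Tendsto (fun n => sampleCov (fun k : Fin n => x k) p q) atTop (𝓝 (b - c * e)) := by
  have h := tendsto_div_sub_one.mul (h2.sub (hp.mul hq))
  rw [one_mul] at h
  refine h.congr fun n => ?_
  rw [sampleCov_apply, inv_mul_sum_fin fun k => x k p * x k q, inv_mul_sum_fin fun k => x k p,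
    inv_mul_sum_fin fun k => x k q]

lemma avg_mul_sub_sub (u v : ℕ → ℝ) (x y : ℝ) {n : ℕ} (hn : n ≠ 0) :
    avg (fun k => (u k - x) * (v k - y)) n =
      avg (fun k => u k * v k) n - x * avg v n - y * avg u n + x * y := by
  have hn' : (n : ℝ) ≠ 0 := by exact_mod_cast hn
  have key : ∀ n : ℕ, ∑ k ∈ Finset.range n, (u k - x) * (v k - y) =
      ∑ k ∈ Finset.range n, u k * v k - x * ∑ k ∈ Finset.range n, v k
        - y * ∑ k ∈ Finset.range n, u k + n * (x * y) := by
    intro n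
    induction n with
    | zero => simp
    | succ n ih => simp only [Finset.sum_range_succ, Nat.cast_succ]; linear_combination ih
  simp only [avg, key]
  field_simp

/-- The centring constants will be sample means, which vary with `n`; the expansion leaves only
averages of fixed sequences, to which the strong law applies. -/
lemma avg_mul_sub_four (a b c e : ℕ → ℝ) (x y z w : ℝ) {n : ℕ} (hn : n ≠ 0) :
    avg (fun k => (a k - x) * (b k - y) * ((c k - z) * (e k - w))) n =
      avg (fun k => a k * b k * (c k * e k)) n
      - w * avg (fun k => a k * b k * c k) n - z * avg (fun k => a k * b k * e k) n
      - y * avg (fun k => a k * c k * e k) n - x * avg (fun k => b k * c k * e k) n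
      + z * w * avg (fun k => a k * b k) n + y * w * avg (fun k => a k * c k) n
      + y * z * avg (fun k => a k * e k) n + x * w * avg (fun k => b k * c k) n
      + x * z * avg (fun k => b k * e k) n + x * y * avg (fun k => c k * e k) n
      - y * z * w * avg a n - x * z * w * avg b n - x * y * w * avg c n - x * y * z * avg e n
      + x * y * z * w := by
  have hn' : (n : ℝ) ≠ 0 := by exact_mod_cast hn
  have key : ∀ n : ℕ, ∑ k ∈ Finset.range n, (a k - x) * (b k - y) * ((c k - z) * (e k - w)) =
      ∑ k ∈ Finset.range n, a k * b k * (c k * e k)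
      - w * ∑ k ∈ Finset.range n, a k * b k * c k - z * ∑ k ∈ Finset.range n, a k * b k * e k
      - y * ∑ k ∈ Finset.range n, a k * c k * e k - x * ∑ k ∈ Finset.range n, b k * c k * e k
      + z * w * ∑ k ∈ Finset.range n, a k * b k + y * w * ∑ k ∈ Finset.range n, a k * c k
      + y * z * ∑ k ∈ Finset.range n, a k * e k + x * w * ∑ k ∈ Finset.range n, b k * c k
      + x * z * ∑ k ∈ Finset.range n, b k * e k + x * y * ∑ k ∈ Finset.range n, c k * e k
      - y * z * w * ∑ k ∈ Finset.range n, a k - x * z * w * ∑ k ∈ Finset.range n, b k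
      - x * y * w * ∑ k ∈ Finset.range n, c k - x * y * z * ∑ k ∈ Finset.range n, e k
      + n * (x * y * z * w) := by
    intro n
    induction n with
    | zero => simp
    | succ n ih => simp only [Finset.sum_range_succ, Nat.cast_succ]; linear_combination ih
  simp only [avg, key]
  field_simp

lemma tendsto_vechSampleCov {d : ℕ} {x : ℕ → EuclideanSpace ℝ (Fin d)}
    {m₂ : Fin d → Fin d → ℝ} {m₃ : Fin d → Fin d → Fin d → ℝ}
    {m₄ : Fin d → Fin d → Fin d → Fin d → ℝ}
    (h1 : ∀ i, Tendsto (avg fun k => x k i) atTop (𝓝 0))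
    (h2 : ∀ i j, Tendsto (avg fun k => x k i * x k j) atTop (𝓝 (m₂ i j)))
    (h3 : ∀ i j l, Tendsto (avg fun k => x k i * x k j * x k l) atTop (𝓝 (m₃ i j l)))
    (h4 : ∀ i j l s, Tendsto (avg fun k => x k i * x k j * (x k l * x k s)) atTop
      (𝓝 (m₄ i j l s)))
    (p q : VechIdx d) :
    Tendsto (fun n => vechSampleCov (fun k : Fin n => x k) p q) atTop
      (𝓝 (m₄ p.1.1 p.1.2 q.1.1 q.1.2 - m₂ p.1.1 p.1.2 * m₂ q.1.1 q.1.2)) := by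
  have c4 : ∀ i j l s, Tendsto (fun n => avg (fun k =>
      (x k i - avg (fun k => x k i) n) * (x k j - avg (fun k => x k j) n) *
      ((x k l - avg (fun k => x k l) n) * (x k s - avg (fun k => x k s) n))) n) atTop
      (𝓝 (m₄ i j l s)) := by
    intro i j l s
    have hi := h1 i
    have hj := h1 j
    have hl := h1 l
    have hs := h1 s
    -- Every correction term contains a first-order average, which tends to `0`, so only the leading
    -- fourth-order average survives.
    have h := ((((((((((((((((h4 i j l s).sub (hs.mul (h3 i j l))).sub (hl.mul (h3 i j s))).sub
      (hj.mul (h3 i l s))).sub (hi.mul (h3 j l s))).add ((hl.mul hs).mul (h2 i j))).add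
      ((hj.mul hs).mul (h2 i l))).add ((hj.mul hl).mul (h2 i s))).add
      ((hi.mul hs).mul (h2 j l))).add ((hi.mul hl).mul (h2 j s))).add
      ((hi.mul hj).mul (h2 l s))).sub (((hj.mul hl).mul hs).mul hi)).sub
      (((hi.mul hl).mul hs).mul hj)).sub (((hi.mul hj).mul hs).mul hl)).sub
      (((hi.mul hj).mul hl).mul hs)).add (((hi.mul hj).mul hl).mul hs))
    simp only [zero_mul, sub_zero, add_zero] at h
    refine h.congr' ?_
    filter_upwards [eventually_ne_atTop 0] with n hn
    exact (avg_mul_sub_four _ _ _ _ _ _ _ _ hn).symm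
  have c2 : ∀ i j, Tendsto (fun n => avg (fun k =>
      (x k i - avg (fun k => x k i) n) * (x k j - avg (fun k => x k j) n)) n) atTop
      (𝓝 (m₂ i j)) := by
    intro i j
    have h := (((h2 i j).sub ((h1 i).mul (h1 j))).sub ((h1 j).mul (h1 i))).add ((h1 i).mul (h1 j))
    simp only [zero_mul, sub_zero, add_zero] at h
    refine h.congr' ?_
    filter_upwards [eventually_ne_atTop 0] with n hn
    exact (avg_mul_sub_sub _ _ _ _ hn).symm
  have h := tendsto_div_sub_one.mul
    ((c4 p.1.1 p.1.2 q.1.1 q.1.2).sub ((c2 p.1.1 p.1.2).mul (c2 q.1.1 q.1.2)))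
  rw [one_mul] at h
  refine h.congr fun n => ?_
  rw [vechSampleCov, sampleCov_apply]
  simp only [vech, Matrix.vecMulVec_apply, PiLp.sub_apply, sampleMean_apply, ← inv_mul_sum_fin]

lemma measurable_sampleCov (p q : ι) :
    Measurable fun x : Fin n → EuclideanSpace ℝ ι => sampleCov x p q := by
  simp only [sampleCov_apply]
  fun_prop

lemma measurable_vechSampleCov {d : ℕ} (p q : VechIdx d) :
    Measurable fun x : Fin n → EuclideanSpace ℝ (Fin d) => vechSampleCov x p q := by
  simp only [vechSampleCov, sampleCov_apply, vech, Matrix.vecMulVec_apply, PiLp.sub_apply, sampleMean_apply]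
  fun_prop

end SampleCov

/-! ### Strong laws for the empirical covariances -/

section LawOfLargeNumbers

variable {Ω ι : Type*} [MeasurableSpace Ω] {P : Measure Ω}

lemma tendsto_avg_of_iid {E : Type*} [MeasurableSpace E] {Z : ℕ → Ω → E}
    (hindep : iIndepFun Z P) (hident : ∀ k, IdentDistrib (Z k) (Z 0) P P) {f : E → ℝ}
    (hf : Measurable f) (hint : Integrable (fun ω => f (Z 0 ω)) P) :
    ∀ᵐ ω ∂P, Tendsto (avg fun k => f (Z k ω)) atTop (𝓝 (∫ ω, f (Z 0 ω) ∂P)) :=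
  strong_law_ae_real (fun k ω => f (Z k ω)) hint
    (fun _ _ hij => (hindep.indepFun hij).comp hf hf) fun k => (hident k).comp hf

variable [IsProbabilityMeasure P]

lemma ae_tendsto_sampleCov [Fintype ι] {Z : ℕ → Ω → EuclideanSpace ℝ ι}
    (hindep : iIndepFun Z P) (hident : ∀ k, IdentDistrib (Z k) (Z 0) P P)
    (hZ : MemLp (Z 0) 2 P) :
    ∀ᵐ ω ∂P, ∀ p q, Tendsto (fun n => sampleCov (fun k : Fin n => Z k ω) p q) atTop
      (𝓝 (popCov P (fun ω => (Z 0 ω).ofLp) p q)) := by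
  have hc : ∀ p, MemLp (fun ω => Z 0 ω p) 2 P := fun p =>
    (EuclideanSpace.proj p : EuclideanSpace ℝ ι →L[ℝ] ℝ).comp_memLp' hZ
  have h1 : ∀ᵐ ω ∂P, ∀ p, Tendsto (avg fun k => Z k ω p) atTop (𝓝 (∫ ω, Z 0 ω p ∂P)) :=
    ae_all_iff.2 fun p => tendsto_avg_of_iid hindep hident
      (f := fun z : EuclideanSpace ℝ ι => z p) (by fun_prop) ((hc p).integrable one_le_two)
  have h2 : ∀ᵐ ω ∂P, ∀ p q, Tendsto (avg fun k => Z k ω p * Z k ω q) atTop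
      (𝓝 (∫ ω, Z 0 ω p * Z 0 ω q ∂P)) :=
    ae_all_iff.2 fun p => ae_all_iff.2 fun q => tendsto_avg_of_iid hindep hident
      (f := fun z : EuclideanSpace ℝ ι => z p * z q) (by fun_prop) ((hc p).integrable_mul (hc q))
  filter_upwards [h1, h2] with ω h1 h2 p q
  have : popCov P (fun ω => (Z 0 ω).ofLp) p q =
      ∫ ω, Z 0 ω p * Z 0 ω q ∂P - (∫ ω, Z 0 ω p ∂P) * ∫ ω, Z 0 ω q ∂P :=
    covariance_eq_sub (hc p) (hc q)
  rw [this]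
  exact tendsto_sampleCov (x := fun k => Z k ω) (h2 p q) (h1 p) (h1 q)

/-- All mixed moments up to order four are dominated by powers of the norm, so the fourth moment
suffices to apply the strong law to each average in `tendsto_vechSampleCov`. -/
lemma ae_tendsto_vechSampleCov {d : ℕ} {Z : ℕ → Ω → EuclideanSpace ℝ (Fin d)}
    (hindep : iIndepFun Z P) (hident : ∀ k, IdentDistrib (Z k) (Z 0) P P)
    (hmean : ∫ ω, Z 0 ω ∂P = 0) (hZ : MemLp (Z 0) 4 P) :
    ∀ᵐ ω ∂P, ∀ p q, Tendsto (fun n => vechSampleCov (fun k : Fin n => Z k ω) p q) atTop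
      (𝓝 (popCov P (fun ω => vech (Matrix.vecMulVec (Z 0 ω).ofLp (Z 0 ω).ofLp)) p q)) := by
  have hpow : ∀ r : ℕ, r ≤ 4 → Integrable (fun ω => ‖Z 0 ω‖ ^ r) P := fun r hr =>
    (hZ.mono_exponent (by exact_mod_cast hr)).integrable_norm_pow'
  have hdom : ∀ (f : EuclideanSpace ℝ (Fin d) → ℝ) (r : ℕ), r ≤ 4 → Measurable f →
      (∀ z, |f z| ≤ ‖z‖ ^ r) → Integrable (fun ω => f (Z 0 ω)) P := fun f r hr hf hb =>
    (hpow r hr).mono' (hf.comp_aemeasurable hZ.1.aemeasurable).aestronglyMeasurable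
      (ae_of_all _ fun ω => hb _)
  have hco : ∀ (z : EuclideanSpace ℝ (Fin d)) i, |z i| ≤ ‖z‖ := fun z i =>
    PiLp.norm_apply_le z i
  have b2 : ∀ i j (z : EuclideanSpace ℝ (Fin d)), |z i * z j| ≤ ‖z‖ ^ 2 := fun i j z => by
    rw [abs_mul, pow_two]
    exact mul_le_mul (hco z i) (hco z j) (abs_nonneg _) (norm_nonneg _)
  have b3 : ∀ i j l (z : EuclideanSpace ℝ (Fin d)), |z i * z j * z l| ≤ ‖z‖ ^ 3 :=
    fun i j l z => by
      rw [abs_mul, pow_succ]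
      exact mul_le_mul (b2 i j z) (hco z l) (abs_nonneg _) (by positivity)
  have b4 : ∀ i j l s (z : EuclideanSpace ℝ (Fin d)), |z i * z j * (z l * z s)| ≤ ‖z‖ ^ 4 :=
    fun i j l s z => by
      rw [abs_mul, show 4 = 2 + 2 from rfl, pow_add]
      exact mul_le_mul (b2 i j z) (b2 l s z) (abs_nonneg _) (by positivity)
  have i1 : ∀ i, Integrable (fun ω => Z 0 ω i) P := fun i =>
    hdom (fun z => z i) 1 (by norm_num) (by fun_prop) fun z => by simpa using hco z i
  have i2 : ∀ i j, Integrable (fun ω => Z 0 ω i * Z 0 ω j) P := fun i j =>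
    hdom (fun z => z i * z j) 2 (by norm_num) (by fun_prop) (b2 i j)
  have i4 : ∀ i j l s, Integrable (fun ω => Z 0 ω i * Z 0 ω j * (Z 0 ω l * Z 0 ω s)) P :=
    fun i j l s => hdom (fun z => z i * z j * (z l * z s)) 4 le_rfl (by fun_prop) (b4 i j l s)
  have hzero : ∀ i, ∫ ω, Z 0 ω i ∂P = 0 := fun i => by
    have := (EuclideanSpace.proj i : EuclideanSpace ℝ (Fin d) →L[ℝ] ℝ).integral_comp_comm
      (hZ.integrable (by norm_num))
    rw [hmean, map_zero] at this
    exact this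
  have h1 : ∀ᵐ ω ∂P, ∀ i, Tendsto (avg fun k => Z k ω i) atTop (𝓝 0) := by
    refine ae_all_iff.2 fun i => ?_
    rw [← hzero i]
    exact tendsto_avg_of_iid hindep hident (f := fun z : EuclideanSpace ℝ (Fin d) => z i)
      (by fun_prop) (i1 i)
  have h2 : ∀ᵐ ω ∂P, ∀ i j, Tendsto (avg fun k => Z k ω i * Z k ω j) atTop
      (𝓝 (∫ ω, Z 0 ω i * Z 0 ω j ∂P)) :=
    ae_all_iff.2 fun i => ae_all_iff.2 fun j => tendsto_avg_of_iid hindep hident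
      (f := fun z : EuclideanSpace ℝ (Fin d) => z i * z j) (by fun_prop) (i2 i j)
  have h3 : ∀ᵐ ω ∂P, ∀ i j l, Tendsto (avg fun k => Z k ω i * Z k ω j * Z k ω l) atTop
      (𝓝 (∫ ω, Z 0 ω i * Z 0 ω j * Z 0 ω l ∂P)) :=
    ae_all_iff.2 fun i => ae_all_iff.2 fun j => ae_all_iff.2 fun l =>
      tendsto_avg_of_iid hindep hident
        (f := fun z : EuclideanSpace ℝ (Fin d) => z i * z j * z l) (by fun_prop)
        (hdom (fun z => z i * z j * z l) 3 (by norm_num) (by fun_prop) (b3 i j l))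
  have h4 : ∀ᵐ ω ∂P, ∀ i j l s,
      Tendsto (avg fun k => Z k ω i * Z k ω j * (Z k ω l * Z k ω s)) atTop
      (𝓝 (∫ ω, Z 0 ω i * Z 0 ω j * (Z 0 ω l * Z 0 ω s) ∂P)) :=
    ae_all_iff.2 fun i => ae_all_iff.2 fun j => ae_all_iff.2 fun l => ae_all_iff.2 fun s =>
      tendsto_avg_of_iid hindep hident
        (f := fun z : EuclideanSpace ℝ (Fin d) => z i * z j * (z l * z s)) (by fun_prop)
        (i4 i j l s)
  -- The square of a product of two coordinates is a fourth-order product, integrable by `i4`.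
  have hL2 : ∀ i j, MemLp (fun ω => Z 0 ω i * Z 0 ω j) 2 P := fun i j => by
    refine (memLp_two_iff_integrable_sq (i2 i j).1).2 ?_
    simpa only [pow_two] using i4 i j i j
  filter_upwards [h1, h2, h3, h4] with ω h1 h2 h3 h4 p q
  have : popCov P (fun ω => vech (Matrix.vecMulVec (Z 0 ω).ofLp (Z 0 ω).ofLp)) p q =
      ∫ ω, Z 0 ω p.1.1 * Z 0 ω p.1.2 * (Z 0 ω q.1.1 * Z 0 ω q.1.2) ∂P -
      (∫ ω, Z 0 ω p.1.1 * Z 0 ω p.1.2 ∂P) * ∫ ω, Z 0 ω q.1.1 * Z 0 ω q.1.2 ∂P :=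
    covariance_eq_sub (hL2 _ _) (hL2 _ _)
  rw [this]
  exact tendsto_vechSampleCov (x := fun k => Z k ω) h1 h2 h3 h4 p q

end LawOfLargeNumbers
-- Gaussian sample covariances, uniformly in the covariance matrix
section GaussianSampleCov

variable {ι : Type*} [Fintype ι]

/-- The probability depends only on the law of the sample, so it can be computed with the first `n`
terms of one infinite i.i.d. sequence, where the strong law is available. -/
lemma tendsto_pi_sampleCov {Ω : Type*} [MeasurableSpace Ω] {Q : Measure Ω}
    [IsProbabilityMeasure Q] {Z : ℕ → Ω → EuclideanSpace ℝ ι} (hZ : ∀ k, Measurable (Z k))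
    (hindep : iIndepFun Z Q) {ν : Measure (EuclideanSpace ℝ ι)} (hlaw : ∀ k, Q.map (Z k) = ν)
    (hν : MemLp id 2 ν) {δ : ℝ} (hδ : 0 < δ) :
    Tendsto (fun n : ℕ => (Measure.pi fun _ : Fin n => ν)
      {z | ¬ ∀ r s, |(sampleCov z - popCov ν fun z => z.ofLp) r s| < δ}) atTop (𝓝 0) := by
  have hident : ∀ k, IdentDistrib (Z k) (Z 0) Q Q :=
    fun k => ⟨(hZ k).aemeasurable, (hZ 0).aemeasurable, by rw [hlaw, hlaw]⟩
  have hmem : MemLp (Z 0) 2 Q := by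
    rw [← hlaw 0] at hν
    exact (memLp_map_measure_iff (by fun_prop) (hZ 0).aemeasurable).1 hν
  have hcov : popCov Q (fun ω => (Z 0 ω).ofLp) = popCov ν fun z => z.ofLp := by
    ext p q
    simp only [popCov, Matrix.of_apply]
    rw [← hlaw 0, covariance_map (by fun_prop) (by fun_prop) (hZ 0).aemeasurable]
    rfl
  have hlim : ∀ r s, Tendsto (fun p : ℕ × Ω => sampleCov (fun k : Fin p.1 => Z k p.2) r s)
      (probFilter Q) (𝓝 (popCov ν (fun z => z.ofLp) r s)) := by
    intro r s
    refine tendsto_probFilter_of_ae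
      (f := fun n ω => sampleCov (fun k : Fin n => Z k ω) r s)
      (fun n => (measurable_sampleCov r s).comp (measurable_pi_lambda _ fun k => hZ k)) ?_
    filter_upwards [ae_tendsto_sampleCov hindep hident hmem] with ω hω
    rw [← hcov]
    exact hω r s
  have hev : ∀ᶠ p in probFilter Q, ∀ r s,
      |(sampleCov (fun k : Fin p.1 => Z k p.2) - popCov ν fun z => z.ofLp) r s| < δ :=
    eventually_all.2 fun r => eventually_all.2 fun s =>
      (hlim r s).eventually (Metric.ball_mem_nhds _ hδ)
  rw [eventually_probFilter (q := fun n ω => ∀ r s,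
    |(sampleCov (fun k : Fin n => Z k ω) - popCov ν fun z => z.ofLp) r s| < δ)] at hev
  refine hev.congr fun n => ?_
  have hmp : Q.map (fun ω (k : Fin n) => Z k ω) = Measure.pi fun _ : Fin n => ν := by
    have := (iIndepFun_iff_map_fun_eq_pi_map (μ := Q) (f := fun (k : Fin n) ω => Z k ω)
      (fun k => (hZ k).aemeasurable)).1
      (hindep.precomp (g := fun k : Fin n => (k : ℕ)) Fin.val_injective)
    rw [this]
    simp only [hlaw]
  have hmeas : Measurable fun ω (k : Fin n) => Z k ω := measurable_pi_lambda _ fun k => hZ k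
  rw [← hmp, Measure.map_apply hmeas]
  · rfl
  · have hset : {z : Fin n → EuclideanSpace ℝ ι |
        ¬ ∀ r s, |(sampleCov z - popCov ν fun z => z.ofLp) r s| < δ} =
        ⋃ r, ⋃ s, {z | δ ≤ |(sampleCov z - popCov ν fun z => z.ofLp) r s|} := by
      ext z
      simp
    rw [hset]
    refine MeasurableSet.iUnion fun r => MeasurableSet.iUnion fun s => ?_
    refine measurableSet_le measurable_const ?_
    simp only [Matrix.sub_apply]
    have := measurable_sampleCov (n := n) r s
    fun_prop

variable [DecidableEq ι]

lemma sampleCov_toEuclideanCLM {n : ℕ} (B : Matrix ι ι ℝ) (z : Fin n → EuclideanSpace ℝ ι) :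
    sampleCov (fun k => Matrix.toEuclideanCLM (𝕜 := ℝ) B (z k)) =
      B * sampleCov z * B.transpose := by
  have hmean : sampleMean (fun k => Matrix.toEuclideanCLM (𝕜 := ℝ) B (z k)) =
      Matrix.toEuclideanCLM (𝕜 := ℝ) B (sampleMean z) := by
    simp [sampleMean]
  simp only [sampleCov, hmean, ← map_sub, Matrix.ofLp_toEuclideanCLM, Matrix.mul_smul,
    Matrix.smul_mul, Matrix.mul_sum, Matrix.sum_mul, Matrix.mul_vecMulVec, Matrix.vecMulVec_mul,
    Matrix.vecMul_transpose]

lemma popCov_stdGaussian :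
    popCov (stdGaussian (EuclideanSpace ℝ ι)) (fun z => z.ofLp) = 1 := by
  ext p q
  rw [← multivariateGaussian_zero_one]
  exact covariance_eval_multivariateGaussian Matrix.PosSemidef.one p q

lemma tendsto_pi_stdGaussian_sampleCov {δ : ℝ} (hδ : 0 < δ) :
    Tendsto (fun n : ℕ => (Measure.pi fun _ : Fin n => stdGaussian (EuclideanSpace ℝ ι))
      {z | ¬ ∀ r s, |(sampleCov z - 1) r s| < δ}) atTop (𝓝 0) := by
  have h := tendsto_pi_sampleCov
    (Q := Measure.infinitePi fun _ : ℕ => stdGaussian (EuclideanSpace ℝ ι))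
    (Z := fun k ω => ω k) (fun k => measurable_pi_apply k)
    (iIndepFun_infinitePi (X := fun _ => id) fun _ => measurable_id)
    (fun k => Measure.infinitePi_map_eval _ k) IsGaussian.memLp_two_id hδ
  rwa [popCov_stdGaussian] at h

/-- A diagonal entry of `B * Bᵀ` is the squared norm of a row of `B`, so the entries of rows `p` and
`q` are at most `√K`; each term of the double sum is then at most `K * δ`. -/
lemma abs_mul_mul_transpose_lt {ι : Type*} [Fintype ι] {B W : Matrix ι ι ℝ} {K δ ε : ℝ} {p q : ι}
    (hp : (B * B.transpose) p p ≤ K) (hq : (B * B.transpose) q q ≤ K)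
    (hW : ∀ r s, |W r s| < δ) (hδ : Fintype.card ι * (Fintype.card ι * (K * δ)) < ε) :
    |(B * W * B.transpose) p q| < ε := by
  have hrow : ∀ t, (B * B.transpose) t t ≤ K → ∀ r, |B t r| ≤ √K := by
    intro t ht r
    refine Real.abs_le_sqrt (le_trans ?_ ht)
    rw [Matrix.mul_apply]
    simp only [Matrix.transpose_apply, ← pow_two]
    exact Finset.single_le_sum (f := fun r => B t r ^ 2) (fun r _ => sq_nonneg _)
      (Finset.mem_univ r)
  have hK : 0 ≤ K := by
    refine le_trans ?_ hp
    rw [Matrix.mul_apply]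
    exact Finset.sum_nonneg fun r _ => mul_self_nonneg _
  refine lt_of_le_of_lt ?_ hδ
  rw [Matrix.mul_apply]
  refine (Finset.abs_sum_le_sum_abs _ _).trans ?_
  rw [← nsmul_eq_mul]
  refine Finset.sum_le_card_nsmul _ _ _ fun s _ => ?_
  rw [Matrix.mul_apply, Finset.sum_mul]
  refine (Finset.abs_sum_le_sum_abs _ _).trans ?_
  rw [← nsmul_eq_mul]
  refine Finset.sum_le_card_nsmul _ _ _ fun r _ => ?_
  rw [abs_mul, abs_mul, Matrix.transpose_apply]
  calc |B p r| * |W r s| * |B q s| ≤ √K * δ * √K := by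
        have h1 := hrow p hp r
        have h2 := hrow q hq s
        have h3 := (hW r s).le
        have h4 := (abs_nonneg _).trans h3
        gcongr
    _ = K * δ := by rw [mul_right_comm, Real.mul_self_sqrt hK]

open scoped MatrixOrder in
-- With `B = √A`, the deviation is `B (W - 1) Bᵀ` for a standard Gaussian sample covariance `W`. The
-- right-hand side does not involve `A`, which allows `A` to be random and to vary with the stage.
lemma pi_multivariateGaussian_sampleCov_le {A : Matrix ι ι ℝ} (hA : A.PosSemidef) {K δ ε : ℝ}
    {p q : ι} (hp : A p p ≤ K) (hq : A q q ≤ K)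
    (hδ : Fintype.card ι * (Fintype.card ι * (K * δ)) < ε) (n : ℕ) :
    (Measure.pi fun _ : Fin n => multivariateGaussian 0 A)
        {y | ε ≤ |sampleCov y p q - A p q|} ≤
      (Measure.pi fun _ : Fin n => stdGaussian (EuclideanSpace ℝ ι))
        {z | ¬ ∀ r s, |(sampleCov z - 1) r s| < δ} := by
  set B := CFC.sqrt A with hB
  have hBt : B.transpose = B := by
    have : B.IsHermitian := (CFC.sqrt_nonneg A).isSelfAdjoint
    simpa [Matrix.IsHermitian] using this
  have hBB : B * B.transpose = A := by rw [hBt, hB, CFC.sqrt_mul_sqrt_self A hA.nonneg]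
  have hmap : (Measure.pi fun _ : Fin n => multivariateGaussian 0 A) =
      (Measure.pi fun _ : Fin n => stdGaussian (EuclideanSpace ℝ ι)).map
        fun z k => Matrix.toEuclideanCLM (𝕜 := ℝ) B (z k) := by
    have h0 : multivariateGaussian 0 A =
        (stdGaussian (EuclideanSpace ℝ ι)).map (Matrix.toEuclideanCLM (𝕜 := ℝ) B) := by
      simp [multivariateGaussian, hB]
    rw [h0, Measure.pi_map_pi (fun _ => by fun_prop)]
  have hmeas : MeasurableSet {y : Fin n → EuclideanSpace ℝ ι | ε ≤ |sampleCov y p q - A p q|} := by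
    have := measurable_sampleCov (n := n) p q
    exact measurableSet_le measurable_const (by fun_prop)
  rw [hmap, Measure.map_apply (by fun_prop) hmeas]
  refine measure_mono fun z hz hW => ?_
  rw [Set.mem_preimage, Set.mem_ofPred_eq, sampleCov_toEuclideanCLM] at hz
  have heq : (B * sampleCov z * B.transpose) p q - A p q =
      (B * (sampleCov z - 1) * B.transpose) p q := by
    rw [Matrix.mul_sub, Matrix.sub_mul, Matrix.mul_one, hBB, Matrix.sub_apply]
  rw [heq] at hz
  exact absurd (abs_mul_mul_transpose_lt (by rwa [hBB]) (by rwa [hBB]) hW hδ) (not_lt.2 hz)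

end GaussianSampleCov

/-! ### Positivity, continuity and measurability of `upsilon` -/

section Upsilon

lemma isClosed_posSemidef {ι : Type*} [Fintype ι] :
    IsClosed {A : Matrix ι ι ℝ | A.PosSemidef} := by
  have : {A : Matrix ι ι ℝ | A.PosSemidef} =
      {A | A.conjTranspose = A} ∩ ⋂ x : ι → ℝ, {A | 0 ≤ star x ⬝ᵥ A.mulVec x} := by
    ext A
    simp only [Set.mem_ofPred_eq, Matrix.posSemidef_iff_dotProduct_mulVec, Set.mem_inter_iff,
      Set.mem_iInter]
    rfl
  rw [this]
  refine (isClosed_eq (by fun_prop) continuous_id).inter (isClosed_iInter fun x => ?_)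
  exact isClosed_le continuous_const (by fun_prop)

variable {d : ℕ}

lemma posSemidef_upsilon (V : Matrix (Fin d) (Fin d) ℝ)
    {S : Matrix (VechIdx d) (VechIdx d) ℝ} (hS : S.PosSemidef) : (upsilon V S).PosSemidef := by
  have := hS.mul_mul_conjTranspose_same (linMatrix (vech V) (vechOff (corrMatrix V)))
  rwa [Matrix.conjTranspose_eq_transpose_of_trivial] at this

lemma linMatrix_apply (v : VechIdx d → ℝ) (r : OffIdx d → ℝ) (l : OffIdx d) (s : VechIdx d) :
    linMatrix v r l s = (elimMatrix d l s - 1 / 2 * (r l * diagSumMatrix d l s)) *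
      (√(v (diagIdx s.1.1) * v (diagIdx s.1.2)))⁻¹ := by
  have h : linMatrix v r = @HMul.hMul _ _ _ Matrix.instHMulOfFintypeOfMulOfAddCommMonoid
      (elimMatrix d - (1 / 2 : ℝ) • @HMul.hMul _ _ _ Matrix.instHMulOfFintypeOfMulOfAddCommMonoid
          (Matrix.diagonal r) (diagSumMatrix d))
      (Matrix.diagonal fun q => (√(v (diagIdx q.1.1) * v (diagIdx q.1.2)))⁻¹) := rfl
  rw [h, Matrix.mul_diagonal, Matrix.sub_apply, Matrix.smul_apply, Matrix.diagonal_mul,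
    smul_eq_mul]

lemma upsilon_apply (V : Matrix (Fin d) (Fin d) ℝ) (S : Matrix (VechIdx d) (VechIdx d) ℝ)
    (p q : OffIdx d) :
    upsilon V S p q = ∑ s, (∑ r, linMatrix (vech V) (vechOff (corrMatrix V)) p r * S r s) *
      linMatrix (vech V) (vechOff (corrMatrix V)) q s := by
  simp only [upsilon, Matrix.mul_apply, Matrix.transpose_apply]

/-- The positive diagonal keeps the denominators of the correlations and of the scaling factors away
from zero. -/
lemma continuousAt_linMatrix {V : Matrix (Fin d) (Fin d) ℝ} (hV : ∀ j, 0 < V j j) (l : OffIdx d)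
    (s : VechIdx d) :
    ContinuousAt (fun U : Matrix (Fin d) (Fin d) ℝ =>
      linMatrix (vech U) (vechOff (corrMatrix U)) l s) V := by
  have hent : ∀ j k, ContinuousAt (fun U : Matrix (Fin d) (Fin d) ℝ => U j k) V := fun j k =>
    (continuous_id.matrix_elem j k).continuousAt
  simp only [linMatrix_apply, vechOff, corrMatrix, Matrix.of_apply, vech, diagIdx]
  have hpos := fun j => Real.sqrt_pos.2 (hV j)
  refine ContinuousAt.mul (continuousAt_const.sub (continuousAt_const.mul
    (((hent _ _).div ((hent _ _).sqrt.mul (hent _ _).sqrt) ?_).mul continuousAt_const)))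
    (((hent _ _).mul (hent _ _)).sqrt.inv₀ ?_)
  · exact (mul_pos (hpos _) (hpos _)).ne'
  · exact (Real.sqrt_pos.2 (mul_pos (hV _) (hV _))).ne'

lemma continuousAt_upsilon {V : Matrix (Fin d) (Fin d) ℝ} (hV : ∀ j, 0 < V j j)
    (S : Matrix (VechIdx d) (VechIdx d) ℝ) :
    ContinuousAt (fun U : Matrix (Fin d) (Fin d) ℝ × Matrix (VechIdx d) (VechIdx d) ℝ =>
      upsilon U.1 U.2) (V, S) := by
  refine continuousAt_pi.2 fun p => continuousAt_pi.2 fun q => ?_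
  have hl : ∀ l s, ContinuousAt
      (fun U : Matrix (Fin d) (Fin d) ℝ × Matrix (VechIdx d) (VechIdx d) ℝ =>
        linMatrix (vech U.1) (vechOff (corrMatrix U.1)) l s) (V, S) := fun l s =>
    (continuousAt_linMatrix hV l s).comp (f := Prod.fst) (x := (V, S)) continuousAt_fst
  have hent : ∀ r s, ContinuousAt
      (fun U : Matrix (Fin d) (Fin d) ℝ × Matrix (VechIdx d) (VechIdx d) ℝ => U.2 r s) (V, S) :=
    fun r s => (continuous_snd.matrix_elem r s).continuousAt
  simp only [upsilon_apply]
  exact tendsto_finsetSum _ fun s _ =>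
    (tendsto_finsetSum _ fun r _ => (hl p r).mul (hent r s)).mul (hl q s)

lemma tendsto_upsilon {α : Type*} {l : Filter α} {Vhat : α → Matrix (Fin d) (Fin d) ℝ}
    {Shat : α → Matrix (VechIdx d) (VechIdx d) ℝ} {V : Matrix (Fin d) (Fin d) ℝ}
    {S : Matrix (VechIdx d) (VechIdx d) ℝ} (hV : ∀ j, 0 < V j j)
    (hVhat : Tendsto Vhat l (𝓝 V)) (hShat : Tendsto Shat l (𝓝 S)) :
    Tendsto (fun x => upsilon (Vhat x) (Shat x)) l (𝓝 (upsilon V S)) := by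
  have hc : Tendsto (fun U : Matrix (Fin d) (Fin d) ℝ × Matrix (VechIdx d) (VechIdx d) ℝ =>
      upsilon U.1 U.2) (𝓝 (V, S)) (𝓝 (upsilon V S)) := continuousAt_upsilon hV S
  have h := hc.comp (hVhat.prodMk_nhds hShat)
  simp only [Function.comp_def] at h
  exact h

lemma measurable_upsilon {α : Type*} [MeasurableSpace α] {V : α → Matrix (Fin d) (Fin d) ℝ}
    {S : α → Matrix (VechIdx d) (VechIdx d) ℝ} (hV : ∀ j k, Measurable fun x => V x j k)
    (hS : ∀ p q, Measurable fun x => S x p q) (p q : OffIdx d) :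
    Measurable fun x => upsilon (V x) (S x) p q := by
  simp only [upsilon_apply, linMatrix_apply, vech, vechOff, corrMatrix, Matrix.of_apply, diagIdx]
  fun_prop

end Upsilon
-- Conditional laws and sample covariances of the bootstrap vectors
section Bootstrap

variable {Ω : Type*} [MeasurableSpace Ω] {P : Measure Ω}

lemma matrixTendstoInProb_iff {ι : Type*} {A : ℕ → Ω → Matrix ι ι ℝ} {B : Matrix ι ι ℝ} :
    MatrixTendstoInProb P A B ↔
      Tendsto (fun p : ℕ × Ω => A p.1 p.2) (probFilter P) (𝓝 B) := by
  simp only [MatrixTendstoInProb, tendstoInMeasure_iff_tendsto_probFilter]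
  refine Iff.trans ?_ tendsto_pi_nhds.symm
  exact forall_congr' fun p => tendsto_pi_nhds.symm

variable {a d : ℕ}

lemma tendsto_upsilonHat {X : Fin a → ℕ → Ω → EuclideanSpace ℝ (Fin d)} {n : ℕ → Fin a → ℕ}
    {Shat : (m : ℕ) → Fin a → Data a d (n m) → Matrix (VechIdx d) (VechIdx d) ℝ} {i : Fin a}
    {V : Matrix (Fin d) (Fin d) ℝ} {S : Matrix (VechIdx d) (VechIdx d) ℝ} (hV : ∀ j, 0 < V j j)
    (hVhat : Tendsto (fun p : ℕ × Ω => sampleCov (observed X (n p.1) p.2 i)) (probFilter P) (𝓝 V))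
    (hShat : Tendsto (fun p : ℕ × Ω => Shat p.1 i (observed X (n p.1) p.2)) (probFilter P) (𝓝 S)) :
    Tendsto (fun p : ℕ × Ω => upsilonHat (Shat p.1 i) i (observed X (n p.1) p.2)) (probFilter P)
      (𝓝 (upsilon V S)) := by
  have h := tendsto_upsilon hV hVhat hShat
  simp only [upsilonHat]
  exact h

lemma tendsto_blockDiagonal {α ι : Type*} {l : Filter α} {A : α → Fin a → Matrix ι ι ℝ}
    {B : Fin a → Matrix ι ι ℝ} (h : ∀ i, Tendsto (fun x => A x i) l (𝓝 (B i))) :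
    Tendsto (fun x => Matrix.blockDiagonal (A x)) l (𝓝 (Matrix.blockDiagonal B)) := by
  have hc : Continuous fun C : Fin a → Matrix ι ι ℝ => Matrix.blockDiagonal C :=
    continuous_id.matrix_blockDiagonal
  exact (hc.tendsto B).comp (tendsto_pi_nhds.2 h)

variable [IsProbabilityMeasure P]

lemma condLawTendstoInProb_multivariateGaussian {ι : Type*} [Fintype ι] [DecidableEq ι]
    {𝓓 : ℕ → Type*} [∀ m, MeasurableSpace (𝓓 m)] {T : ℕ → Ω → EuclideanSpace ℝ ι}
    {D : (m : ℕ) → Ω → 𝓓 m} {A : ℕ → Ω → Matrix ι ι ℝ} {B : Matrix ι ι ℝ}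
    (hT : ∀ᶠ p in probFilter P,
      condDistrib (T p.1) (D p.1) P (D p.1 p.2) = multivariateGaussian 0 (A p.1 p.2))
    (hpos : ∀ᶠ p in probFilter P, (A p.1 p.2).PosSemidef)
    (hA : Tendsto (fun p : ℕ × Ω => A p.1 p.2) (probFilter P) (𝓝 B)) :
    CondLawTendstoInProb P T D (multivariateGaussian 0 B) := by
  -- Positivity passes to the limit because `probFilter P` is nontrivial.
  have hB : B.PosSemidef := isClosed_posSemidef.mem_of_tendsto hA hpos
  refine tendstoInMeasure_iff_tendsto_probFilter.2 ?_
  have h := (tendsto_levyProkhorovDist_multivariateGaussian hB).comp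
    (tendsto_nhdsWithin_iff.2 ⟨hA, hpos⟩)
  refine h.congr' ?_
  filter_upwards [hT] with p hp
  rw [hp]
  rfl

lemma map_pi_pi_sampleMean {n : Fin a → ℕ} {A : Fin a → Matrix (OffIdx d) (OffIdx d) ℝ}
    (hA : ∀ i, (A i).PosSemidef) (c : ℝ) (i : Fin a) :
    (Measure.pi fun i => Measure.pi fun _ : Fin (n i) => multivariateGaussian 0 (A i)).map
        (fun y : BootArray a d n => c • sampleMean (y i)) =
      multivariateGaussian 0 ((c ^ 2 / n i) • A i) := by
  rw [← map_pi_multivariateGaussian_sampleMean (hA i),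
    ← (measurePreserving_eval (fun i => Measure.pi fun _ : Fin (n i) =>
      multivariateGaussian (0 : EuclideanSpace ℝ (OffIdx d)) (A i)) i).map_eq,
    Measure.map_map (g := fun y : Fin (n i) → EuclideanSpace ℝ (OffIdx d) => c • sampleMean y)
      (by unfold sampleMean; fun_prop) (measurable_pi_apply i)]
  rfl

lemma map_pi_pi_pooledMean {n : Fin a → ℕ} {A : Fin a → Matrix (OffIdx d) (OffIdx d) ℝ}
    (hA : ∀ i, (A i).PosSemidef) (c : ℝ) :
    (Measure.pi fun i => Measure.pi fun _ : Fin (n i) => multivariateGaussian 0 (A i)).map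
        (fun y : BootArray a d n => c • pooledMean y) =
      multivariateGaussian 0 (Matrix.blockDiagonal fun i => (c ^ 2 / n i) • A i) := by
  rw [← map_pi_multivariateGaussian_blockDiagonal fun i => (hA i).smul (by positivity)]
  simp_rw [← map_pi_multivariateGaussian_sampleMean (hA _)]
  rw [← Measure.pi_map_pi
      (f := fun i (y : Fin (n i) → EuclideanSpace ℝ (OffIdx d)) => c • sampleMean y)
      (fun i => by unfold sampleMean; fun_prop),
    Measure.map_map (by fun_prop) (by unfold sampleMean; fun_prop)]
  rfl

lemma measurable_observed {X : Fin a → ℕ → Ω → EuclideanSpace ℝ (Fin d)}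
    (hX : ∀ i k, Measurable (X i k)) (n : Fin a → ℕ) : Measurable (observed X n) :=
  measurable_pi_lambda _ fun i => measurable_pi_lambda _ fun k => hX i k

/-- If `Υ̂` is consistent, so is the sample covariance matrix of the bootstrap vectors. -/
lemma tendsto_sampleCov_bootstrap {X : Fin a → ℕ → Ω → EuclideanSpace ℝ (Fin d)}
    (hX : ∀ i k, Measurable (X i k)) {n : ℕ → Fin a → ℕ}
    {Shat : (m : ℕ) → Fin a → Data a d (n m) → Matrix (VechIdx d) (VechIdx d) ℝ}
    (hS : ∀ m i p q, Measurable fun x => Shat m i x p q)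
    {Y : (m : ℕ) → Ω → BootArray a d (n m)}
    (hY : ∀ m, IsParametricBootstrap P X (n m) (Shat m) (Y m))
    {i : Fin a} (hn : Tendsto (fun m => n m i) atTop atTop)
    {B : Matrix (OffIdx d) (OffIdx d) ℝ}
    (hpos : ∀ᶠ p in probFilter P,
      (upsilonHat (Shat p.1 i) i (observed X (n p.1) p.2)).PosSemidef)
    (hlim : Tendsto (fun p : ℕ × Ω => upsilonHat (Shat p.1 i) i (observed X (n p.1) p.2))
      (probFilter P) (𝓝 B)) :
    Tendsto (fun p : ℕ × Ω => sampleCov (Y p.1 p.2 i)) (probFilter P) (𝓝 B) := by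
  refine tendsto_pi_nhds.2 fun r => tendsto_pi_nhds.2 fun s => ?_
  have hent : ∀ r s, Tendsto
      (fun p : ℕ × Ω => upsilonHat (Shat p.1 i) i (observed X (n p.1) p.2) r s)
      (probFilter P) (𝓝 (B r s)) := fun r s =>
    tendsto_pi_nhds.1 (tendsto_pi_nhds.1 hlim r) s
  suffices h : Tendsto (fun p : ℕ × Ω => sampleCov (Y p.1 p.2 i) r s -
      upsilonHat (Shat p.1 i) i (observed X (n p.1) p.2) r s) (probFilter P) (𝓝 0) by
    simpa using h.add (hent r s)
  refine Metric.tendsto_nhds.2 fun θ hθ => ?_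
  -- The added `1` makes `K` strictly larger than both limits, so it bounds the diagonal entries of
  -- `Υ̂ᵢ` at `r` and `s` with probability tending to one.
  set K : ℝ := max (B r r) (B s s) + 1
  obtain ⟨δ, hδ, hδlt⟩ : ∃ δ : ℝ, 0 < δ ∧
      Fintype.card (OffIdx d) * (Fintype.card (OffIdx d) * (K * δ)) < θ := by
    have hc : Tendsto (fun δ : ℝ => Fintype.card (OffIdx d) * (Fintype.card (OffIdx d) * (K * δ)))
        (𝓝[>] 0) (𝓝 0) := by
      have : Continuous fun δ : ℝ =>
          (Fintype.card (OffIdx d) : ℝ) * (Fintype.card (OffIdx d) * (K * δ)) := by fun_prop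
      simpa using (this.tendsto 0).mono_left nhdsWithin_le_nhds
    obtain ⟨δ, h1, h2⟩ := ((hc.eventually_lt_const hθ).and self_mem_nhdsWithin).exists
    exact ⟨δ, h2, h1⟩
  have hUm : ∀ m r s, Measurable fun x : Data a d (n m) => upsilonHat (Shat m i) i x r s :=
    fun m r s => measurable_upsilon
      (fun j k => (measurable_sampleCov j k).comp (measurable_pi_apply i)) (hS m i) r s
  let W : (m : ℕ) → Set (Data a d (n m) × BootArray a d (n m)) := fun m =>
    {z | θ ≤ |sampleCov (z.2 i) r s - upsilonHat (Shat m i) i z.1 r s|}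
  have hW : ∀ m, MeasurableSet (W m) := fun m => by
    have h1 : Measurable fun z : Data a d (n m) × BootArray a d (n m) =>
        sampleCov (z.2 i) r s :=
      (measurable_sampleCov r s).comp ((measurable_pi_apply i).comp measurable_snd)
    have h2 : Measurable fun z : Data a d (n m) × BootArray a d (n m) =>
        upsilonHat (Shat m i) i z.1 r s := (hUm m r s).comp measurable_fst
    exact measurableSet_le measurable_const (h1.sub h2).abs
  have hobs := fun m => measurable_observed hX (n m)
  have hcond : ∀ᶠ p in probFilter P,
      condDistrib (Y p.1) (observed X (n p.1)) P (observed X (n p.1) p.2) =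
        Measure.pi fun i => Measure.pi fun _ : Fin (n p.1 i) =>
          multivariateGaussian 0 (upsilonHat (Shat p.1 i) i (observed X (n p.1) p.2)) :=
    eventually_probFilter_of_ae fun m => ae_of_ae_map (hobs m).aemeasurable (hY m).2
  -- This bound depends on the stage only, not on the data.
  have hη := (tendsto_pi_stdGaussian_sampleCov (ι := OffIdx d) hδ).comp
    (hn.comp (tendsto_fst_probFilter (P := P)))
  have hBorel : ∀ m, StandardBorelSpace (BootArray a d (n m)) := fun _ => inferInstance
  have hBorel : ∀ m, StandardBorelSpace (BootArray a d (n m)) := fun _ => inferInstance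
  have key := tendsto_measure_of_condDistrib (𝓨 := fun m => BootArray a d (n m)) hobs (fun m => (hY m).1) hW
    (tendsto_of_tendsto_of_tendsto_of_le_of_le' tendsto_const_nhds hη
      (Eventually.of_forall fun _ => zero_le) (by
        filter_upwards [hcond, hpos,
          (hent r r).eventually_lt_const ((le_max_left (B r r) (B s s)).trans_lt (lt_add_one _)),
          (hent s s).eventually_lt_const ((le_max_right (B r r) (B s s)).trans_lt (lt_add_one _))]
          with p h1 h2 h3 h4
        rw [h1]
        refine le_trans (le_of_eq ?_)
          (pi_multivariateGaussian_sampleCov_le h2 h3.le h4.le hδlt (n p.1 i))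
        -- The event concerns group `i` alone, so its probability under the full product is that
        -- under the `i`-th factor.
        refine (measurePreserving_eval (fun i => Measure.pi fun _ : Fin (n p.1 i) =>
          multivariateGaussian (0 : EuclideanSpace ℝ (OffIdx d))
            (upsilonHat (Shat p.1 i) i (observed X (n p.1) p.2))) i).measure_preimage
          (s := {y | θ ≤ |sampleCov y r s -
            upsilonHat (Shat p.1 i) i (observed X (n p.1) p.2) r s|})
          (MeasurableSet.nullMeasurableSet ?_)
        have := measurable_sampleCov (n := n p.1 i) r s
        exact measurableSet_le measurable_const (by fun_prop)))
  change Tendsto (fun m => P {ω | ¬ dist (sampleCov (Y m ω i) r s -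
      upsilonHat (Shat m i) i (observed X (n m) ω) r s) 0 < θ}) atTop (𝓝 0)
  refine key.congr fun m => ?_
  congr 1
  ext ω
  simp [W]

end Bootstrap
end CorrBootstrap

/-! ### The theorem -/

open CorrBootstrap in
theorem theorem3 {Ω : Type*} [MeasurableSpace Ω] (P : Measure Ω) [IsProbabilityMeasure P]
    (a d : ℕ) (hd : 2 ≤ d)
    (μ : Fin a → EuclideanSpace ℝ (Fin d))
    (ε X : Fin a → ℕ → Ω → EuclideanSpace ℝ (Fin d))
    (hX : ∀ i k ω, X i k ω = μ i + ε i k ω)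
    (hmeas : ∀ i k, Measurable (ε i k))
    (hindep : iIndepFun (fun s : Fin a × ℕ => ε s.1 s.2) P)
    (hident : ∀ i k, IdentDistrib (ε i k) (ε i 0) P P)
    (hcentred : ∀ i, ∫ ω, ε i 0 ω ∂P = 0)
    (hmoment : ∀ i, MemLp (ε i 0) 4 P)
    (V : Fin a → Matrix (Fin d) (Fin d) ℝ)
    (hV : ∀ i, V i = popCov P (fun ω => (ε i 0 ω).ofLp))
    (hVpos : ∀ i j, 0 < V i j j)
    (S : Fin a → Matrix (VechIdx d) (VechIdx d) ℝ)
    (hS : ∀ i, S i = popCov P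
      (fun ω => vech (Matrix.vecMulVec (ε i 0 ω).ofLp (ε i 0 ω).ofLp)))
    -- the asymptotic regime for the sample sizes
    (n : ℕ → Fin a → ℕ) (κ : Fin a → ℝ)
    (hn : ∀ i, Tendsto (fun m => n m i) atTop atTop)
    (hκ : ∀ i, κ i ∈ Set.Ioc (0 : ℝ) 1)
    (hA1 : ∀ i, Tendsto (fun m => (n m i : ℝ) / total (n m)) atTop (𝓝 (κ i))) :
    -- the empirical covariance matrix of the `vech (X̃ X̃ᵀ)` is a possible estimator of `S`
    IsConsistentCovEstimator P X n S (fun _ i x => vechSampleCov (x i)) ∧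
    -- for every consistent estimator of `S`:
    ∀ Shat : (m : ℕ) → Fin a → Data a d (n m) → Matrix (VechIdx d) (VechIdx d) ℝ,
      IsConsistentCovEstimator P X n S Shat →
      ∀ Y : (m : ℕ) → Ω → BootArray a d (n m),
        (∀ m, IsParametricBootstrap P X (n m) (Shat m) (Y m)) →
        (∀ i, CondLawTendstoInProb P
          (fun m ω => √(total (n m)) • sampleMean (Y m ω i))
          (fun m => observed X (n m))
          (multivariateGaussian 0 ((κ i)⁻¹ • upsilon (V i) (S i)))) ∧
        CondLawTendstoInProb P
          (fun m ω => √(total (n m)) • pooledMean (Y m ω))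
          (fun m => observed X (n m))
          (multivariateGaussian 0
            (Matrix.blockDiagonal fun i => (κ i)⁻¹ • upsilon (V i) (S i))) ∧
        (∀ i, MatrixTendstoInProb P (fun m ω => sampleCov (Y m ω i)) (upsilon (V i) (S i))) ∧
        MatrixTendstoInProb P
          (fun m ω => Matrix.blockDiagonal fun i =>
            (total (n m) / (n m i : ℝ)) • sampleCov (Y m ω i))
          (Matrix.blockDiagonal fun i => (κ i)⁻¹ • upsilon (V i) (S i)) := by
  have hXm : ∀ i k, Measurable (X i k) := fun i k => by
    have : X i k = fun ω => μ i + ε i k ω := funext fun ω => hX i k ω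
    rw [this]
    exact (hmeas i k).const_add (μ i)
  have hobs : ∀ m, Measurable (observed X (n m)) := fun m => measurable_observed hXm (n m)
  have hshift : ∀ m i ω, observed X (n m) ω i = fun k : Fin (n m i) => μ i + ε i k ω :=
    fun m i ω => funext fun k => hX i k ω
  have hindep' : ∀ i, iIndepFun (ε i) P := fun i =>
    hindep.precomp (g := fun k : ℕ => (i, k)) (Prod.mk_right_injective i)
  have hVhat : ∀ i, Tendsto (fun p : ℕ × Ω => sampleCov (observed X (n p.1) p.2 i))
      (probFilter P) (𝓝 (V i)) := by
    refine fun i => tendsto_pi_nhds.2 fun j => tendsto_pi_nhds.2 fun k => ?_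
    refine tendsto_probFilter_of_ae (f := fun m ω => sampleCov (observed X (n m) ω i) j k)
      (fun m => (measurable_sampleCov j k).comp ((measurable_pi_apply i).comp (hobs m))) ?_
    filter_upwards [ae_tendsto_sampleCov (hindep' i) (hident i)
      ((hmoment i).mono_exponent (by norm_num))] with ω hω
    simp only [hshift, sampleCov_const_add, hV]
    exact (hω j k).comp (hn i)
  have hvechMeas : ∀ m i p q, Measurable fun x : Data a d (n m) => vechSampleCov (x i) p q :=
    fun m i p q => (measurable_vechSampleCov p q).comp (measurable_pi_apply i)
  have hvech : IsConsistentCovEstimator P X n S fun _ i x => vechSampleCov (x i) := by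
    refine ⟨hvechMeas, fun m i => ae_of_all _ fun ω => posSemidef_sampleCov _, fun i => ?_⟩
    intro r s
    refine tendstoInMeasure_iff_tendsto_probFilter.2 ?_
    refine tendsto_probFilter_of_ae (f := fun m ω => vechSampleCov (observed X (n m) ω i) r s)
      (fun m => (hvechMeas m i r s).comp (hobs m)) ?_
    filter_upwards [ae_tendsto_vechSampleCov (hindep' i) (hident i) (hcentred i) (hmoment i)]
      with ω hω
    simp only [hshift, vechSampleCov_const_add, hS]
    exact (hω r s).comp (hn i)
  refine ⟨hvech, ?_⟩
  intro Shat hShat Y hY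
  set U : Fin a → ℕ → Ω → Matrix (OffIdx d) (OffIdx d) ℝ := fun i m ω =>
    upsilonHat (Shat m i) i (observed X (n m) ω) with hU
  have hUlim : ∀ i, Tendsto (fun p : ℕ × Ω => U i p.1 p.2) (probFilter P)
      (𝓝 (upsilon (V i) (S i))) := fun i => by
    have h := matrixTendstoInProb_iff.1 (hShat.consistent i)
    exact tendsto_upsilonHat (hVpos i) (hVhat i) h
  have hUpos : ∀ᶠ p in probFilter P, ∀ i, (U i p.1 p.2).PosSemidef :=
    eventually_all.2 fun i => eventually_probFilter_of_ae
      (q := fun m ω => (U i m ω).PosSemidef) fun m => by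
        filter_upwards [hShat.posSemidef m i] with ω hω using posSemidef_upsilon _ hω
  have hratio : ∀ i, Tendsto (fun m => total (n m) / (n m i : ℝ)) atTop (𝓝 (κ i)⁻¹) := fun i => by
    simpa using (hA1 i).inv₀ (hκ i).1.ne'
  have htotal : ∀ m, 0 ≤ total (n m) := fun m => Finset.sum_nonneg fun i _ => Nat.cast_nonneg _
  have hscaled : ∀ i, Tendsto (fun p : ℕ × Ω => (total (n p.1) / (n p.1 i : ℝ)) • U i p.1 p.2)
      (probFilter P) (𝓝 ((κ i)⁻¹ • upsilon (V i) (S i))) := fun i =>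
    ((hratio i).comp tendsto_fst_probFilter).smul (hUlim i)
  have hscaledPos : ∀ᶠ p in probFilter P, ∀ i,
      ((total (n p.1) / (n p.1 i : ℝ)) • U i p.1 p.2).PosSemidef := by
    filter_upwards [hUpos] with p hp i
    exact (hp i).smul (div_nonneg (htotal _) (Nat.cast_nonneg _))
  -- The conditional law of a measurable statistic is the image of the bootstrap law; this serves
  -- both the group means and the pooled mean.
  have hcond : ∀ {ι : Type} [Fintype ι] {f : (m : ℕ) → BootArray a d (n m) → EuclideanSpace ℝ ι},
      (∀ m, Measurable (f m)) → ∀ᶠ p in probFilter P,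
      condDistrib (fun ω => f p.1 (Y p.1 ω)) (observed X (n p.1)) P (observed X (n p.1) p.2) =
        (Measure.pi fun i => Measure.pi fun _ : Fin (n p.1 i) =>
          multivariateGaussian 0 (U i p.1 p.2)).map (f p.1) := by
    intro ι _ f hf
    refine eventually_probFilter_of_ae (q := fun m ω =>
      condDistrib (fun ω => f m (Y m ω)) (observed X (n m)) P (observed X (n m) ω) =
        (Measure.pi fun i => Measure.pi fun _ : Fin (n m i) =>
          multivariateGaussian 0 (U i m ω)).map (f m)) fun m => ?_
    filter_upwards [ae_of_ae_map (hobs m).aemeasurable (hY m).2,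
      ae_of_ae_map (hobs m).aemeasurable
        (condDistrib_comp (observed X (n m)) (hY m).1.aemeasurable (hf m))] with ω h1 h2
    rw [← h1, ← Kernel.map_apply _ (hf m)]
    exact h2
  have hYcov : ∀ i, Tendsto (fun p : ℕ × Ω => sampleCov (Y p.1 p.2 i)) (probFilter P)
      (𝓝 (upsilon (V i) (S i))) := fun i =>
    tendsto_sampleCov_bootstrap hXm hShat.measurable hY (hn i) (hUpos.mono fun p hp => hp i)
      (hUlim i)
  have hblock := tendsto_blockDiagonal hscaled
  have hYblock := tendsto_blockDiagonal fun i =>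
    ((hratio i).comp (tendsto_fst_probFilter (P := P))).smul (hYcov i)
  refine ⟨fun i => ?_, ?_, fun i => matrixTendstoInProb_iff.2 (hYcov i), ?_⟩
  · refine condLawTendstoInProb_multivariateGaussian
      (A := fun m ω => (total (n m) / (n m i : ℝ)) • U i m ω) ?_
      (hscaledPos.mono fun p hp => hp i) (hscaled i)
    filter_upwards [hcond (f := fun m y => √(total (n m)) • sampleMean (y i))
      (fun m => by unfold sampleMean; fun_prop), hUpos] with p h1 h2
    -- The scale `c = √N` turns the covariance factor `c ^ 2 / nᵢ` into `N / nᵢ`, whose limit is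
    -- `κᵢ⁻¹`.
    rw [h1, map_pi_pi_sampleMean h2, Real.sq_sqrt (htotal _)]
  · refine condLawTendstoInProb_multivariateGaussian
      (A := fun m ω => Matrix.blockDiagonal fun i => (total (n m) / (n m i : ℝ)) • U i m ω) ?_
      (hscaledPos.mono fun p hp => posSemidef_blockDiagonal hp) hblock
    filter_upwards [hcond (f := fun m y => √(total (n m)) • pooledMean y)
      (fun m => by unfold pooledMean sampleMean; fun_prop), hUpos] with p h1 h2
    rw [h1, map_pi_pi_pooledMean h2]
    simp only [Real.sq_sqrt (htotal _)]
  · exact matrixTendstoInProb_iff.2 hYblock
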